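/- **Definitions.** Let $\overline{\mathbb D}=\{z\in\mathbb C:|z|\le 1\}$, let $\mathbb T$ be the unit circle $\{z\in\mathbb C:|z|=1\}$, and let $\mathcal P(\mathbb T)$ be the space of Borel probability measures on $\mathbb T$ with the topology of weak convergence. For $\alpha\in\overline{\mathbb D}$ put $\rho(\alpha)=\sqrt{1-|\alpha|^2}$ and $$\Xi(\alpha)=\begin{pmatrix}\overline{\alpha}&\rho(\alpha)\\ \rho(\alpha)&-\alpha\end{pmatrix}.$$ For even $N\ge 2$ and $\alpha_1,\dots,\alpha_N\in\overline{\mathbb D}$, write $\rho_j=\rho(\alpha_j)$, $\Xi_j=\Xi(\alpha_j)$. Let $\mathcal L=\operatorname{diag}(\Xi_1,\Xi_3,\dots,\Xi_{N-1})$, let $$\mathcal M=\begin{pmatrix}-\alpha_N&&&&\rho_N\\&\Xi_2&&&\\&&\ddots&&\\&&&\Xi_{N-2}&\\ \rho_N&&&&\overline{\alpha_N}\end{pmatrix}$$ (for $N=2$, $\mathcal M=\begin{pmatrix}-\alpha_2&\rho_2\\ \rho_2&\overline{\alpha_2}\end{pmatrix}$), and let $\mathcal E=\mathcal L\mathcal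 M$ be the periodic CMV matrix with Verblunsky coefficients $\alpha_1,\dots,\alpha_N$. It is unitary; if $\lambda_1,\dots,\lambda_N\in\mathbb T$ are its eigenvalues, counted with multiplicity, its empirical measure is $\mu_N(\mathcal E)=\frac1N\sum_{j=1}^N\delta_{\lambda_j}\in\mathcal P(\mathbb T)$. **Proposition 2.3.** Let $\sigma$ be a Borel probability measure on $\mathbb C$ with $\operatorname{supp}(\sigma)\subseteq\overline{\mathbb D}$. There is a function $J:\mathcal P(\mathbb T)\to[0,+\infty]$, depending only on $\sigma$, such that the following holds. 1. $J$ is convex, and its level sets $\{\mu\in\mathcal P(\mathbb T): J(\mu)\le a\}$, $0\le a<\infty$, are compact. 2. Let $(\alpha_i)_{i\ge1}$ be i.i.d. random variables of law $\sigma$ on some probability space with probability $\mathbb P$, and for even $N\ge2$ let $\mu_N(\mathcal E)$ be the empirical measure of the eigenvalues of the $N\times N$ periodic CMV matrix with Verblunsky coefficients $\alpha_1,\dots,\alpha_N$. Then for every open set $O\subseteq\mathcal P(\mathbb T)$ $$-\inf_O J\le\liminf_{N\to\infty,\ N\text{ even}}\frac1N\ln\mathbb P\bigl(\mu_N(\mathcal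 E)\in O\bigr),$$ and for every closed set $F\subseteq\mathcal P(\mathbb T)$ $$\limsup_{N\to\infty,\ N\text{ even}}\frac1N\ln\mathbb P\bigl(\mu_N(\mathcal E)\in F\bigr)\le-\inf_F J,$$ with the conventions $\ln 0=-\infty$ and $\inf_\emptyset J=+\infty$. -/

import Mathlib

open MeasureTheory ProbabilityTheory Filter Topology
open scoped ENNReal NNReal ComplexConjugate

/-- The unit circle carries its Borel sigma-algebra. -/
noncomputable instance : MeasurableSpace Circle := borel Circle

instance : BorelSpace Circle := ⟨rfl⟩

namespace CMV

noncomputable section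

/-- The quantity `ρ = √(1 - |α|²)` attached to a Verblunsky coefficient `α`, `|α| ≤ 1`. -/
def rho (α : ℂ) : ℝ := Real.sqrt (1 - ‖α‖ ^ 2)

/-- The `2 × 2` matrix `Ξ(α)`; it is unitary when `|α| ≤ 1`. -/
def Xi (α : ℂ) : Matrix (Fin 2) (Fin 2) ℂ :=
  !![conj α, (rho α : ℂ);
     (rho α : ℂ), -α]

/-- The `N × N` matrix built from `2 × 2` blocks `Ξ(a j)`, one for each index `j` with `start j`;
the block of `j` occupies the rows and columns `j` and `j + 1 mod N`, in this order.
This is used only where exactly one of `j`, `j + 1 mod N` satisfies `start`, so that the blocks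
tile the cyclically ordered index set. Here `finRotate N` is `j ↦ j + 1 mod N`. -/
def cyclicBlocks {N : ℕ} (start : Fin N → Prop) [DecidablePred start] (a : Fin N → ℂ) :
    Matrix (Fin N) (Fin N) ℂ :=
  Matrix.of fun j k =>
    if start j then
      if k = j then Xi (a j) 0 0
      else if k = finRotate N j then Xi (a j) 0 1
      else 0
    else
      if k = j then Xi (a ((finRotate N).symm j)) 1 1
      else if k = (finRotate N).symm j then Xi (a ((finRotate N).symm j)) 1 0
      else 0

/-- `𝓛 = diag(Ξ₁, Ξ₃, …, Ξ_{N-1})` for even `N`. Rows, columns and coefficients are numbered from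
`0`: the entry `a j` is the Verblunsky coefficient `α_{j+1}`, so the blocks start at the even
indices `j`. -/
def matL {N : ℕ} (a : Fin N → ℂ) : Matrix (Fin N) (Fin N) ℂ :=
  cyclicBlocks (fun j => Even (j : ℕ)) a

/-- `𝓜` for even `N`: the blocks `Ξ₂, Ξ₄, …, Ξ_{N-2}` along the diagonal, shifted by one, and the
block `Ξ_N` wrapped around the corners, with `-α_N` in the top left corner, `conj α_N` in the
bottom right corner, and `ρ_N` in the two others. With the numbering from `0` the blocks start at
the odd indices. -/
def matM {N : ℕ} (a : Fin N → ℂ) : Matrix (Fin N) (Fin N) ℂ :=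
  cyclicBlocks (fun j => Odd (j : ℕ)) a

/-- The periodic CMV matrix `𝓔 = 𝓛 𝓜` with Verblunsky coefficients `a` (for even `N`). -/
def periodicCMV {N : ℕ} (a : Fin N → ℂ) : Matrix (Fin N) (Fin N) ℂ :=
  matL a * matM a

/-- The probability measure `N⁻¹ ∑ⱼ δ_{exp(i θⱼ)}` on the unit circle, where `θⱼ` are the arguments
of the eigenvalues `λⱼ` of `A`, listed with algebraic multiplicity (the roots of the
characteristic polynomial). When `A` is unitary, `exp(i θⱼ) = λⱼ`, and this is the empirical
measure of the eigenvalues of `A`. -/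
def empiricalMeasure {N : ℕ} [NeZero N] (A : Matrix (Fin N) (Fin N) ℂ) :
    ProbabilityMeasure Circle :=
  ⟨(N : ℝ≥0∞)⁻¹ • (A.charpoly.roots.map fun z => Measure.dirac (Circle.exp z.arg)).sum, by
    have key : ∀ s : Multiset ℂ,
        ((s.map fun z => Measure.dirac (Circle.exp z.arg)).sum : Measure Circle) Set.univ
          = (Multiset.card s : ℝ≥0∞) := by
      intro s
      induction s using Multiset.induction_on with
      | empty => simp
      | cons z s ih => simp [ih, add_comm]
    have hcard : Multiset.card A.charpoly.roots = N := by
      rw [IsAlgClosed.card_roots_eq_natDegree, Matrix.charpoly_natDegree_eq_dim, Fintype.card_fin]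
    constructor
    rw [Measure.smul_apply, key, hcard, smul_eq_mul]
    exact ENNReal.inv_mul_cancel (by exact_mod_cast NeZero.ne N) (ENNReal.natCast_ne_top N)⟩

end

end CMV

/-!
The argument is subadditivity in the number of coefficients. If `a` and `b` are two vectors of
Verblunsky coefficients of even lengths `N` and `M`, the periodic CMV matrix of their concatenation
differs from the direct sum of the matrices of `a` and `b` only through four rows of the factor `𝓜`
(`matL_append`, `matM_append`). As all matrices are unitary, the trace of the `k`-th power changes
by at most `8 k`, uniformly in the sizes (`norm_trace_periodicCMV_append_sub_le`). The traces of the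
powers are `N` times the moments of the empirical measure (`moment_empiricalMeasure`), and the
moments determine the topology on the compact space of probability measures on the circle
(`exists_momentBall_subset`, `momentBall_mem_nhds`). Hence the probability that the empirical
measure lies near a given `μ` is supermultiplicative in `N`, up to a small enlargement of the
neighbourhood (`traceProb_mul_le`).

The rate function `rate σ μ` is the infimum of the exponents `a` with `Good σ a μ`, that is, such
that every neighbourhood of `μ` eventually has probability at least `exp (-a N)`.
Supermultiplicativity shows that it is enough to have this bound for arbitrarily large `N`
(`good_of_frequently`). So if `a` is not such an exponent, some neighbourhood of `μ` eventually has
probability less than `exp (-a N)`. The first form gives the lower bound for open sets, and the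
second one, with a finite cover, the upper bound for closed sets, which are compact here. The same
dichotomy shows that the rate function is lower semicontinuous (`isClosed_setOf_good`). Convexity
follows by concatenating in the proportions `s` and `t` (`Good.convex`).
-/

/-! ### Traces of powers of unitary matrices -/

open Polynomial in
theorem Matrix.charpoly_pow_eq_prod {n : Type*} [Fintype n] [DecidableEq n]
    (A : Matrix n n ℂ) (k : ℕ) :
    (A ^ k).charpoly = (A.charpoly.roots.map fun z => X - C (z ^ k)).prod := by
  set s := A.charpoly.roots with hs
  have hcard : Multiset.card s = Fintype.card n := by
    rw [hs, IsAlgClosed.card_roots_eq_natDegree, Matrix.charpoly_natDegree_eq_dim]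
  have hchar : A.charpoly = (s.map fun z => X - C z).prod :=
    (IsAlgClosed.splits A.charpoly).eq_prod_roots_of_monic A.charpoly_monic
  -- The identity `det (p A) = ∏ p (λ)` is multiplicative in `p`, so linear factors suffice.
  have hconst : ∀ c : ℂ, (aeval A (C c)).det = (s.map (C c).eval).prod := by
    intro c
    simp [Matrix.algebraMap_eq_diagonal, Matrix.det_diagonal, hcard]
  have hlin : ∀ c : ℂ, (aeval A (C c - X)).det = (s.map (C c - X).eval).prod := by
    intro c
    have h := congrArg (Polynomial.eval c) hchar
    rw [Matrix.eval_charpoly, eval_multiset_prod, Multiset.map_map] at h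
    simpa [Matrix.algebraMap_eq_diagonal, Pi.algebraMap_def] using h
  have hmul : ∀ p q : ℂ[X], (aeval A p).det = (s.map p.eval).prod →
      (aeval A q).det = (s.map q.eval).prod →
      (aeval A (p * q)).det = (s.map (p * q).eval).prod := by
    intro p q hp hq
    rw [map_mul, Matrix.det_mul, hp, hq, ← Multiset.prod_map_mul]
    simp
  have hdet : ∀ p : ℂ[X], (aeval A p).det = (s.map p.eval).prod := by
    intro p
    rw [(IsAlgClosed.splits p).eq_prod_roots]
    refine hmul _ _ (hconst _) ?_
    induction p.roots using Multiset.induction_on with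
    | empty => simp
    | cons z t ih =>
      rw [Multiset.map_cons, Multiset.prod_cons]
      refine hmul _ _ ?_ ih
      rw [show (X - C z : ℂ[X]) = C (-1) * (C z - X) by simp]
      exact hmul _ _ (hconst _) (hlin _)
  refine Polynomial.funext fun x => ?_
  have h := hdet (C x - X ^ k)
  rw [Matrix.eval_charpoly, eval_multiset_prod, Multiset.map_map]
  simpa [Matrix.algebraMap_eq_diagonal, Pi.algebraMap_def] using h

theorem Matrix.trace_pow_eq_sum_roots {n : Type*} [Fintype n] [DecidableEq n]
    (A : Matrix n n ℂ) (k : ℕ) :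
    (A ^ k).trace = (A.charpoly.roots.map (· ^ k)).sum := by
  rw [Matrix.trace_eq_sum_roots_charpoly, Matrix.charpoly_pow_eq_prod]
  have := Polynomial.roots_multiset_prod_X_sub_C (A.charpoly.roots.map (· ^ k))
  rw [Multiset.map_map] at this
  exact congrArg Multiset.sum this

/-- The entries of a unitary matrix are bounded by one, and only the rows in which `M` and `M'`
differ contribute to the trace. -/
theorem Matrix.norm_trace_mul_le_card {n : Type*} [Fintype n] [DecidableEq n]
    {M M' W : Matrix n n ℂ} (hM : M ∈ unitaryGroup n ℂ) (hM' : M' ∈ unitaryGroup n ℂ)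
    (hW : W ∈ unitaryGroup n ℂ) (R : Finset n) (hR : ∀ i ∉ R, M i = M' i) :
    ‖((M - M') * W).trace‖ ≤ 2 * R.card := by
  have hb : ∀ i, ‖((M - M') * W) i i‖ ≤ 2 := by
    intro i
    rw [sub_mul, Matrix.sub_apply]
    refine (norm_sub_le _ _).trans ?_
    have h1 := entry_norm_bound_of_unitary (mul_mem hM hW) i i
    have h2 := entry_norm_bound_of_unitary (mul_mem hM' hW) i i
    linarith
  have hz : ∀ i ∉ R, ((M - M') * W) i i = 0 := by
    intro i hi
    simp [Matrix.mul_apply, hR i hi]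
  rw [show ((M - M') * W).trace = ∑ i ∈ R, ((M - M') * W) i i from
    (Finset.sum_subset (Finset.subset_univ R) fun i _ hi => hz i hi).symm]
  refine (norm_sum_le_of_le R fun i _ => hb i).trans ?_
  simp [mul_comm]

/-- Changing a unitary factor in few rows changes the trace of the `k`-th power by an amount that
does not depend on the size of the matrices. -/
theorem Matrix.norm_trace_pow_sub_pow_le {n : Type*} [Fintype n] [DecidableEq n]
    {L M M' : Matrix n n ℂ} (hL : L ∈ unitaryGroup n ℂ) (hM : M ∈ unitaryGroup n ℂ)
    (hM' : M' ∈ unitaryGroup n ℂ) (R : Finset n) (hR : ∀ i ∉ R, M i = M' i) (k : ℕ) :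
    ‖((L * M) ^ k).trace - ((L * M') ^ k).trace‖ ≤ 2 * R.card * k := by
  -- The extra unitary factor `W` makes the induction on `k` work.
  suffices h : ∀ W ∈ unitaryGroup n ℂ,
      ‖(W * ((L * M) ^ k - (L * M') ^ k)).trace‖ ≤ 2 * R.card * k by
    simpa [Matrix.trace_sub] using h 1 (one_mem _)
  induction k with
  | zero => simp
  | succ k ih =>
    intro W hW
    have e : W * ((L * M) ^ (k + 1) - (L * M') ^ (k + 1))
        = (W * L) * ((M - M') * (L * M) ^ k)
          + (W * (L * M')) * ((L * M) ^ k - (L * M') ^ k) := by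
      simp only [pow_succ', Matrix.mul_sub, Matrix.sub_mul, Matrix.mul_assoc]
      abel
    rw [e, Matrix.trace_add, Matrix.trace_mul_comm, Matrix.mul_assoc]
    refine (norm_add_le _ _).trans ?_
    have h1 := Matrix.norm_trace_mul_le_card hM hM'
      (mul_mem (pow_mem (mul_mem hL hM) k) (mul_mem hW hL)) R hR
    have h2 := ih _ (mul_mem hW (mul_mem hL hM'))
    push_cast
    linarith

theorem Matrix.norm_trace_le_card_of_unitary {n : Type*} [Fintype n] [DecidableEq n]
    {U : Matrix n n ℂ} (hU : U ∈ unitaryGroup n ℂ) : ‖U.trace‖ ≤ Fintype.card n := by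
  refine (norm_sum_le_of_le Finset.univ fun i _ => entry_norm_bound_of_unitary hU i i).trans ?_
  simp

open scoped Matrix.Norms.L2Operator in
theorem Matrix.norm_eq_one_of_mem_roots_charpoly {n : Type*} [Fintype n] [DecidableEq n]
    {U : Matrix n n ℂ} (hU : U ∈ unitaryGroup n ℂ) {z : ℂ} (hz : z ∈ U.charpoly.roots) :
    ‖z‖ = 1 :=
  spectrum.norm_eq_one_of_unitary hU
    (Matrix.mem_spectrum_of_isRoot_charpoly (Polynomial.isRoot_of_mem_roots hz))

/-- A criterion for unitarity of a matrix made of `2 × 2` blocks on the pairs `{i, π i}`, with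
diagonal entries `d` and off-diagonal entries `o`. -/
theorem Matrix.mem_unitaryGroup_of_involutive {n : Type*} [Fintype n] [DecidableEq n]
    {π : n → n} (hπ : π.Involutive) (hne : ∀ i, π i ≠ i) {d o : n → ℂ}
    (h1 : ∀ i, d i * conj (d i) + o i * conj (o i) = 1)
    (h2 : ∀ i, d i * conj (o (π i)) + o i * conj (d (π i)) = 0) :
    (Matrix.of fun i k => if k = i then d i else if k = π i then o i else 0) ∈
      unitaryGroup n ℂ := by
  rw [Matrix.mem_unitaryGroup_iff]
  set A : Matrix n n ℂ := Matrix.of fun i k => if k = i then d i else if k = π i then o i else 0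
    with hA
  have hr : ∀ i (f : n → ℂ), ∑ k, A i k * f k = d i * f i + o i * f (π i) := by
    intro i f
    have : ∀ k, A i k * f k = (if k = i then d i * f k else 0)
        + (if k = π i then o i * f k else 0) := by
      intro k
      by_cases hk : k = i
      · subst hk
        simp [hA, (hne k).symm]
      · by_cases hk' : k = π i <;> simp [hA, hk, hk']
        simp [← hk', hk]
    simp [this, Finset.sum_add_distrib]
  ext i j
  rw [Matrix.mul_apply, hr i fun k => star A k j]
  simp only [Matrix.star_apply, Complex.star_def]
  by_cases hij : i = j
  · subst hij
    simpa [hA, hne i] using h1 i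
  · by_cases hij' : j = π i
    · subst hij'
      simpa [hA, hij, hπ i] using h2 i
    · have : π i ≠ π j := fun h => hij (hπ.injective h)
      have h3 : i ≠ π j := fun h => hij' (by rw [h, hπ])
      simp [hA, hij, Ne.symm hij', this, h3]

theorem val_finRotate {N : ℕ} (j : Fin N) :
    (finRotate N j : ℕ) = if (j : ℕ) + 1 = N then 0 else (j : ℕ) + 1 := by
  cases N with
  | zero => exact j.elim0
  | succ n =>
    rw [coe_finRotate]
    simp [Fin.ext_iff]

theorem val_finRotate_symm {N : ℕ} (j : Fin N) :
    ((finRotate N).symm j : ℕ) = if (j : ℕ) = 0 then N - 1 else (j : ℕ) - 1 := by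
  obtain ⟨i, rfl⟩ := (finRotate N).surjective j
  rw [Equiv.symm_apply_apply, val_finRotate]
  by_cases h : (i : ℕ) + 1 = N
  · simp only [h, if_true]
    omega
  · simp [h]

namespace CMV

/-! ### Unitarity of periodic CMV matrices -/

theorem ofReal_rho_sq {α : ℂ} (hα : ‖α‖ ≤ 1) : (rho α : ℂ) * rho α = 1 - conj α * α := by
  have h : rho α * rho α = 1 - ‖α‖ ^ 2 :=
    Real.mul_self_sqrt (by nlinarith [norm_nonneg α])
  rw [← Complex.ofReal_mul, h, mul_comm (conj α), Complex.mul_conj, Complex.normSq_eq_norm_sq]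
  push_cast
  rfl

/-- If every step of the rotation changes the truth value of `start`, the blocks tile the index
set, and `cyclicBlocks start a` is unitary. -/
theorem cyclicBlocks_mem_unitaryGroup {N : ℕ} (start : Fin N → Prop) [DecidablePred start]
    {a : Fin N → ℂ} (hstart : ∀ j, start (finRotate N j) ↔ ¬ start j) (ha : ∀ j, ‖a j‖ ≤ 1) :
    cyclicBlocks start a ∈ Matrix.unitaryGroup (Fin N) ℂ := by
  have hsymm : ∀ j, start ((finRotate N).symm j) ↔ ¬ start j := by
    intro j
    have := hstart ((finRotate N).symm j)
    rw [Equiv.apply_symm_apply] at this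
    tauto
  have hsq := fun j => ofReal_rho_sq (ha j)
  -- `π` exchanges the two indices of each block.
  let π : Fin N → Fin N := fun j => if start j then finRotate N j else (finRotate N).symm j
  have hπ : π.Involutive := by
    intro j
    by_cases hj : start j
    · simp [-finRotate_apply, -finRotate_symm_apply, π, hj, hstart]
    · simp [-finRotate_apply, -finRotate_symm_apply, π, hj, hsymm]
  have hne : ∀ j, π j ≠ j := by
    intro j h
    by_cases hj : start j
    · have := hstart j
      simp only [π, hj, if_true] at h
      rw [h] at this
      tauto
    · have := hsymm j
      simp only [π, hj, if_false] at h
      rw [h] at this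
      tauto
  have key := Matrix.mem_unitaryGroup_of_involutive hπ hne
    (d := fun j => if start j then conj (a j) else -a ((finRotate N).symm j))
    (o := fun j => if start j then (rho (a j) : ℂ) else rho (a ((finRotate N).symm j)))
    (fun j => by
      by_cases hj : start j
      · simp [hj, hsq]
      · simp [-finRotate_symm_apply, hj, hsq]
        ring)
    (fun j => by
      by_cases hj : start j
      · simp [-finRotate_apply, -finRotate_symm_apply, π, hj, hstart]
        ring
      · simp [-finRotate_apply, -finRotate_symm_apply, π, hj, hsymm]
        ring)
  convert key using 1
  ext j k
  by_cases hj : start j <;> simp [cyclicBlocks, Xi, π, hj]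

theorem even_finRotate {N : ℕ} (hN : Even N) (j : Fin N) :
    Even (finRotate N j : ℕ) ↔ ¬ Even (j : ℕ) := by
  rw [val_finRotate]
  split_ifs with h
  · rw [← h, Nat.even_add_one] at hN
    simpa using hN
  · rw [Nat.even_add_one]

theorem matL_mem_unitaryGroup {N : ℕ} (hN : Even N) {a : Fin N → ℂ} (ha : ∀ j, ‖a j‖ ≤ 1) :
    matL a ∈ Matrix.unitaryGroup (Fin N) ℂ :=
  cyclicBlocks_mem_unitaryGroup _ (even_finRotate hN) ha

theorem matM_mem_unitaryGroup {N : ℕ} (hN : Even N) {a : Fin N → ℂ} (ha : ∀ j, ‖a j‖ ≤ 1) :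
    matM a ∈ Matrix.unitaryGroup (Fin N) ℂ :=
  cyclicBlocks_mem_unitaryGroup _
    (fun j => by simpa only [← Nat.not_even_iff_odd, not_iff_not] using even_finRotate hN j) ha

theorem periodicCMV_mem_unitaryGroup {N : ℕ} (hN : Even N) {a : Fin N → ℂ}
    (ha : ∀ j, ‖a j‖ ≤ 1) : periodicCMV a ∈ Matrix.unitaryGroup (Fin N) ℂ :=
  mul_mem (matL_mem_unitaryGroup hN ha) (matM_mem_unitaryGroup hN ha)

theorem norm_trace_periodicCMV_pow_le {N : ℕ} (hN : Even N) {a : Fin N → ℂ}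
    (ha : ∀ j, ‖a j‖ ≤ 1) (k : ℕ) : ‖(periodicCMV a ^ k).trace‖ ≤ N := by
  simpa using Matrix.norm_trace_le_card_of_unitary
    (pow_mem (periodicCMV_mem_unitaryGroup hN ha) k)

/-! ### Concatenation of coefficients -/

/-- The rows of `cyclicBlocks` that stay inside a piece of the index set: if `f` embeds one cyclic
index set into another one, respects the coefficients, and maps the block of `i` to the block of
`f i`, then row `f i` of the large matrix is row `i` of the small one, extended by zero. -/
theorem cyclicBlocks_apply_of_injective {N N' : ℕ} {start : Fin N → Prop} [DecidablePred start]
    {start' : Fin N' → Prop} [DecidablePred start'] {a : Fin N → ℂ} {a' : Fin N' → ℂ}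
    {f : Fin N → Fin N'} (hf : f.Injective) (ha : ∀ j, a' (f j) = a j) {i : Fin N}
    (hi : start' (f i) ↔ start i) (h1 : start i → finRotate N' (f i) = f (finRotate N i))
    (h2 : ¬ start i → (finRotate N').symm (f i) = f ((finRotate N).symm i)) :
    (∀ k, cyclicBlocks start' a' (f i) (f k) = cyclicBlocks start a i k) ∧
      ∀ m ∉ Set.range f, cyclicBlocks start' a' (f i) m = 0 := by
  have hm : ∀ m ∉ Set.range f, ∀ k, m ≠ f k := fun m hm k h => hm ⟨k, h.symm⟩
  by_cases hs : start i
  · refine ⟨fun k => ?_, fun m hmr => ?_⟩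
    · simp [-finRotate_apply, -finRotate_symm_apply, cyclicBlocks, hi, hs, h1 hs, hf.eq_iff, ha]
    · simp [-finRotate_apply, -finRotate_symm_apply, cyclicBlocks, hi, hs, h1 hs, hm m hmr]
  · refine ⟨fun k => ?_, fun m hmr => ?_⟩
    · simp [-finRotate_apply, -finRotate_symm_apply, cyclicBlocks, hi, hs, h2 hs, hf.eq_iff, ha]
    · simp [-finRotate_apply, -finRotate_symm_apply, cyclicBlocks, hi, hs, h2 hs, hm m hmr]

/-- The block that contains row `i` does not wrap around from the last index to the first. The
predicate `start` marks the first rows of the blocks. -/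
def Interior {N : ℕ} (start : ℕ → Prop) (i : Fin N) : Prop :=
  (start i → (i : ℕ) + 1 ≠ N) ∧ (¬ start i → (i : ℕ) ≠ 0)

/-- Away from the wrapping blocks, the matrix of a concatenation agrees with the direct sum. -/
theorem cyclicBlocks_append_row {N M : ℕ} (start : ℕ → Prop) [DecidablePred start]
    (hstart : ∀ j, start (N + j) ↔ start j) (a : Fin N → ℂ) (b : Fin M → ℂ)
    (r : Fin N ⊕ Fin M) (hr : Sum.elim (Interior start) (Interior start) r) :
    ((cyclicBlocks (fun j : Fin (N + M) => start j) (Fin.append a b)).submatrix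
      finSumFinEquiv finSumFinEquiv) r =
    Matrix.fromBlocks (cyclicBlocks (fun j : Fin N => start j) a) 0 0
      (cyclicBlocks (fun j : Fin M => start j) b) r := by
  rcases r with i | i
  · have hr : Interior start i := hr
    have key := cyclicBlocks_apply_of_injective (start := fun j : Fin N => start j)
      (start' := fun j : Fin (N + M) => start j) (a := a) (a' := Fin.append a b)
      (Fin.castAdd_injective N M) (fun j => Fin.append_left a b j) (i := i) (by simp)
      (fun h => by
        have := hr.1 h
        ext
        simp only [val_finRotate, Fin.val_castAdd]
        split_ifs <;> omega)
      (fun h => by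
        have := hr.2 h
        ext
        simp only [val_finRotate_symm, Fin.val_castAdd]
        rw [if_neg this, if_neg this])
    ext (k | k)
    · simpa using key.1 k
    · simp only [Matrix.submatrix_apply, finSumFinEquiv_apply_left, finSumFinEquiv_apply_right,
        Matrix.fromBlocks_apply₁₂, Matrix.zero_apply]
      refine key.2 _ ?_
      rintro ⟨m, hm⟩
      have := congrArg Fin.val hm
      simp only [Fin.val_castAdd, Fin.val_natAdd] at this
      omega
  · have hr : Interior start i := hr
    have key := cyclicBlocks_apply_of_injective (start := fun j : Fin M => start j)
      (start' := fun j : Fin (N + M) => start j) (a := b) (a' := Fin.append a b)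
      (Fin.natAdd_injective M N) (fun j => Fin.append_right a b j) (i := i) (by simp [hstart])
      (fun h => by
        have := hr.1 h
        ext
        simp only [val_finRotate, Fin.val_natAdd]
        split_ifs <;> omega)
      (fun h => by
        have := hr.2 h
        ext
        simp only [val_finRotate_symm, Fin.val_natAdd]
        split_ifs <;> omega)
    ext (k | k)
    · simp only [Matrix.submatrix_apply, finSumFinEquiv_apply_left, finSumFinEquiv_apply_right,
        Matrix.fromBlocks_apply₂₁, Matrix.zero_apply]
      refine key.2 _ ?_
      rintro ⟨m, hm⟩
      have := congrArg Fin.val hm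
      simp only [Fin.val_castAdd, Fin.val_natAdd] at this
      omega
    · simpa using key.1 k

theorem matL_append {N M : ℕ} (hN : Even N) (hM : Even M) (a : Fin N → ℂ) (b : Fin M → ℂ) :
    (matL (Fin.append a b)).submatrix finSumFinEquiv finSumFinEquiv =
      Matrix.fromBlocks (matL a) 0 0 (matL b) := by
  have hint : ∀ {n : ℕ}, Even n → ∀ i : Fin n, Interior Even i := fun hn i =>
    ⟨fun h h' => by rw [← h', Nat.even_add_one] at hn; exact hn h, fun h h' => h (by simp [h'])⟩
  funext r
  exact cyclicBlocks_append_row Even (fun j => by simp [Nat.even_add, hN]) a b r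
    (by rcases r with i | i; exacts [hint hN i, hint hM i])

/-- The first and the last index. -/
def endpoints (N : ℕ) : Finset (Fin N) :=
  Finset.univ.filter fun i => (i : ℕ) = 0 ∨ (i : ℕ) + 1 = N

theorem card_endpoints_le (N : ℕ) : (endpoints N).card ≤ 2 := by
  refine (Finset.card_le_card_of_injOn (t := {0, N - 1}) Fin.val ?_
    Fin.val_injective.injOn).trans Finset.card_le_two
  intro i hi
  simp only [endpoints, Finset.coe_filter, Finset.mem_univ, true_and, Set.mem_ofPred_eq] at hi
  simp only [Finset.coe_insert, Finset.coe_singleton, Set.mem_insert_iff, Set.mem_singleton_iff]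
  omega

/-- In contrast to `matL_append`, the rows of `matM` that belong to the wrapping blocks have to be
left out: the concatenation has one wrapping block, the direct sum has two. -/
theorem matM_append {N M : ℕ} (hN : Even N) (a : Fin N → ℂ) (b : Fin M → ℂ)
    (r : Fin N ⊕ Fin M) (hr : r ∉ (endpoints N).disjSum (endpoints M)) :
    (matM (Fin.append a b)).submatrix finSumFinEquiv finSumFinEquiv r =
      Matrix.fromBlocks (matM a) 0 0 (matM b) r := by
  refine cyclicBlocks_append_row Odd
    (fun j => by simp [← Nat.not_even_iff_odd, Nat.even_add, hN]) a b r ?_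
  rcases r with i | i <;> simp [endpoints] at hr <;>
    exact ⟨fun _ => hr.2, fun _ => hr.1⟩

/-- Concatenating two sets of coefficients adds the traces of the powers of the periodic CMV
matrices, up to an error that does not depend on the sizes: the matrix of the concatenation
differs from the direct sum in the four rows that meet the blocks wrapping around. -/
theorem norm_trace_periodicCMV_append_sub_le {N M : ℕ} (hN : Even N) (hM : Even M)
    {a : Fin N → ℂ} {b : Fin M → ℂ} (ha : ∀ j, ‖a j‖ ≤ 1) (hb : ∀ j, ‖b j‖ ≤ 1) (k : ℕ) :
    ‖(periodicCMV (Fin.append a b) ^ k).trace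
      - ((periodicCMV a ^ k).trace + (periodicCMV b ^ k).trace)‖ ≤ 8 * k := by
  have hab : ∀ j, ‖Fin.append a b j‖ ≤ 1 := fun j => by
    refine Fin.addCases (fun i => ?_) (fun i => ?_) j <;> simp [ha, hb]
  have hsub : ∀ A ∈ Matrix.unitaryGroup (Fin (N + M)) ℂ,
      A.submatrix finSumFinEquiv finSumFinEquiv ∈ Matrix.unitaryGroup (Fin N ⊕ Fin M) ℂ := by
    intro A hA
    rw [Matrix.mem_unitaryGroup_iff] at hA ⊢
    rw [Matrix.star_eq_conjTranspose, Matrix.conjTranspose_submatrix, Matrix.submatrix_mul_equiv,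
      ← Matrix.star_eq_conjTranspose, hA, Matrix.submatrix_one_equiv]
  have hblock : ∀ A ∈ Matrix.unitaryGroup (Fin N) ℂ, ∀ B ∈ Matrix.unitaryGroup (Fin M) ℂ,
      Matrix.fromBlocks A 0 0 B ∈ Matrix.unitaryGroup (Fin N ⊕ Fin M) ℂ := by
    intro A hA B hB
    rw [Matrix.mem_unitaryGroup_iff, Matrix.star_eq_conjTranspose] at hA hB ⊢
    simp [Matrix.fromBlocks_conjTranspose, Matrix.fromBlocks_multiply, hA, hB]
  have hpow : ((periodicCMV (Fin.append a b)).submatrix finSumFinEquiv finSumFinEquiv ^ k).trace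
      = (periodicCMV (Fin.append a b) ^ k).trace := by
    have := map_pow (Matrix.reindexAlgEquiv ℂ ℂ (finSumFinEquiv (m := N) (n := M)).symm)
      (periodicCMV (Fin.append a b)) k
    simp only [Matrix.coe_reindexAlgEquiv, Matrix.reindex_apply, Equiv.symm_symm] at this
    rw [← this]
    exact Equiv.sum_comp finSumFinEquiv fun i => (periodicCMV (Fin.append a b) ^ k) i i
  have hsplit : (periodicCMV (Fin.append a b)).submatrix finSumFinEquiv finSumFinEquiv
      = Matrix.fromBlocks (matL a) 0 0 (matL b) *
        (matM (Fin.append a b)).submatrix finSumFinEquiv finSumFinEquiv := by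
    rw [← matL_append hN hM, Matrix.submatrix_mul_equiv, periodicCMV]
  have key := Matrix.norm_trace_pow_sub_pow_le
    (hblock _ (matL_mem_unitaryGroup hN ha) _ (matL_mem_unitaryGroup hM hb))
    (hsub _ (matM_mem_unitaryGroup (hN.add hM) hab))
    (hblock _ (matM_mem_unitaryGroup hN ha) _ (matM_mem_unitaryGroup hM hb))
    _ (matM_append hN a b) k
  rw [← hsplit, hpow, Matrix.fromBlocks_multiply] at key
  simp only [Matrix.mul_zero, Matrix.zero_mul, add_zero, zero_add, Matrix.fromBlocks_diagonal_pow,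
    Matrix.trace, Fintype.sum_sum_type, Matrix.diag_apply, Matrix.fromBlocks_apply₁₁,
    Matrix.fromBlocks_apply₂₂] at key
  refine key.trans ?_
  have h1 := card_endpoints_le N
  have h2 := card_endpoints_le M
  have h3 : (((endpoints N).disjSum (endpoints M)).card : ℝ) ≤ 4 := by
    rw [Finset.card_disjSum]
    exact_mod_cast (by omega : (endpoints N).card + (endpoints M).card ≤ 4)
  have : (0 : ℝ) ≤ k := Nat.cast_nonneg k
  nlinarith

/-! ### Continuity in the coefficients -/

theorem continuous_rho : Continuous rho := by
  unfold rho
  fun_prop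

theorem continuous_cyclicBlocks {N : ℕ} (start : Fin N → Prop) [DecidablePred start] :
    Continuous fun a : Fin N → ℂ => cyclicBlocks start a := by
  have := continuous_rho
  refine continuous_matrix fun j k => ?_
  simp only [cyclicBlocks, Xi, Matrix.of_apply]
  split_ifs <;> simp [-finRotate_symm_apply, continuous_const] <;> fun_prop

theorem continuous_trace_periodicCMV_pow (N k : ℕ) :
    Continuous fun a : Fin N → ℂ => (periodicCMV a ^ k).trace := by
  unfold periodicCMV matL matM
  exact (((continuous_cyclicBlocks _).matrix_mul (continuous_cyclicBlocks _)).pow k).matrix_trace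

/-! ### Moments of measures on the circle -/

/-- The `k`-th moment `∫ z ^ k dμ` of a probability measure on the unit circle. -/
noncomputable def moment (μ : ProbabilityMeasure Circle) (k : ℕ) : ℂ :=
  ∫ z : Circle, (z : ℂ) ^ k ∂(μ : Measure Circle)

theorem integrable_circle {f : Circle → ℂ} (hf : Continuous f) (μ : Measure Circle)
    [IsFiniteMeasure μ] : Integrable f μ :=
  (BoundedContinuousFunction.mkOfCompact ⟨f, hf⟩).integrable μ

theorem continuous_moment (k : ℕ) : Continuous fun μ => moment μ k := by
  have hc : Continuous fun z : Circle => (z : ℂ) ^ k := by fun_prop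
  rw [continuous_iff_continuousAt]
  intro μ
  exact (ProbabilityMeasure.tendsto_iff_forall_integral_rclike_tendsto ℂ).1 tendsto_id
    (BoundedContinuousFunction.mkOfCompact ⟨_, hc⟩)

theorem integral_conj_pow (μ : ProbabilityMeasure Circle) (k : ℕ) :
    ∫ z : Circle, conj (z : ℂ) ^ k ∂(μ : Measure Circle) = conj (moment μ k) := by
  rw [moment, ← integral_conj]
  simp

/-- The moments of order `k ≥ 0` determine those of order `-k` by conjugation, and by the
Stone-Weierstrass theorem all of them together determine the measure. -/
theorem moment_injective : Function.Injective moment := by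
  intro μ ν h
  let χ : BoundedContinuousFunction Circle ℂ :=
    BoundedContinuousFunction.mkOfCompact ⟨fun z => (z : ℂ), by fun_prop⟩
  have hmon : ∀ g ∈ Submonoid.closure ({χ} ∪ star {χ}),
      ∃ k : ℕ, (∀ z : Circle, g z = (z : ℂ) ^ k) ∨ ∀ z : Circle, g z = conj (z : ℂ) ^ k := by
    intro g hg
    obtain ⟨m, n, rfl⟩ : ∃ m n : ℕ, g = χ ^ m * star χ ^ n := by
      rw [Set.star_singleton, Set.singleton_union] at hg
      obtain ⟨m, n, rfl⟩ := (Submonoid.mem_closure_pair _ _ _).1 hg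
      exact ⟨m, n, rfl⟩
    have hval : ∀ z : Circle, (χ ^ m * star χ ^ n) z = (z : ℂ) ^ m * conj (z : ℂ) ^ n :=
      fun z => by
        rw [BoundedContinuousFunction.coe_mul, Pi.mul_apply]
        simp only [BoundedContinuousFunction.coe_pow, Pi.pow_apply]
        rfl
    have hone : ∀ z : Circle, (z : ℂ) * conj (z : ℂ) = 1 := fun z => by
      rw [Complex.mul_conj, Circle.normSq_coe, Complex.ofReal_one]
    rcases le_total n m with hmn | hmn
    · refine ⟨m - n, Or.inl fun z => ?_⟩
      rw [hval, ← Nat.sub_add_cancel hmn, pow_add, mul_assoc, ← mul_pow, hone]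
      simp
    · refine ⟨n - m, Or.inr fun z => ?_⟩
      rw [hval, ← Nat.sub_add_cancel hmn, pow_add, mul_left_comm, ← mul_pow, hone]
      simp
  refine Subtype.ext (ext_of_forall_mem_subalgebra_integral_eq_of_polish
    (P := (μ : Measure Circle)) (P' := (ν : Measure Circle))
    (A := StarAlgebra.adjoin ℂ {χ}) ?_ ?_)
  · intro x y hxy
    refine ⟨χ, ⟨χ.toContinuousMap, ⟨χ, StarAlgebra.self_mem_adjoin_singleton ℂ χ, rfl⟩, rfl⟩, ?_⟩
    exact fun h => hxy (Circle.ext h)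
  · intro g hg
    rw [← StarSubalgebra.mem_toSubalgebra, StarAlgebra.adjoin_toSubalgebra,
      ← Subalgebra.mem_toSubmodule, Algebra.adjoin_eq_span] at hg
    induction hg using Submodule.span_induction with
    | mem g hg =>
      obtain ⟨k, hk | hk⟩ := hmon g hg
      · simp only [hk]
        exact congrFun h k
      · simp only [hk]
        exact (integral_conj_pow μ k).trans
          ((congrArg conj (congrFun h k)).trans (integral_conj_pow ν k).symm)
    | zero => simp
    | add f g _ _ hf hg =>
      simp only [BoundedContinuousFunction.coe_add, Pi.add_apply]
      rw [integral_add (f.integrable _) (g.integrable _),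
        integral_add (f.integrable _) (g.integrable _), hf, hg]
    | smul c g _ hg =>
      simp only [BoundedContinuousFunction.coe_smul]
      rw [integral_smul, integral_smul, hg]

/-- The measures whose first moments, up to order `K`, are `ε`-close to those of `μ`. -/
def momentBall (μ : ProbabilityMeasure Circle) (K : ℕ) (ε : ℝ) :
    Set (ProbabilityMeasure Circle) :=
  {ν | ∀ k ≤ K, ‖moment ν k - moment μ k‖ ≤ ε}

theorem momentBall_mem_nhds (μ : ProbabilityMeasure Circle) (K : ℕ) {ε : ℝ} (hε : 0 < ε) :
    momentBall μ K ε ∈ 𝓝 μ := by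
  have h : ∀ k ∈ Set.Iic K, {ν | ‖moment ν k - moment μ k‖ ≤ ε} ∈ 𝓝 μ := by
    intro k _
    have hc : Continuous fun ν => ‖moment ν k - moment μ k‖ :=
      ((continuous_moment k).sub continuous_const).norm
    exact hc.continuousAt (Iic_mem_nhds (by simpa using hε))
  have := (Filter.biInter_mem (Set.finite_Iic K)).2 h
  filter_upwards [this] with ν hν k hk
  exact Set.mem_iInter₂.1 hν k hk

/-- The moments embed the compact space of probability measures on the circle into a product, so the
sets `momentBall` form a basis of neighbourhoods. -/
theorem exists_momentBall_subset {μ : ProbabilityMeasure Circle}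
    {U : Set (ProbabilityMeasure Circle)} (hU : U ∈ 𝓝 μ) :
    ∃ K : ℕ, ∃ ε > 0, momentBall μ K ε ⊆ U := by
  have hemb : IsClosedEmbedding moment :=
    (continuous_pi continuous_moment).isClosedEmbedding moment_injective
  rw [hemb.isInducing.nhds_eq_comap, nhds_pi, mem_comap] at hU
  obtain ⟨V, hV, hVU⟩ := hU
  rw [Filter.mem_pi] at hV
  obtain ⟨I, hI, t, ht, htV⟩ := hV
  choose ε hε hεt using fun i => Metric.mem_nhds_iff.1 (ht i)
  obtain ⟨K, hK⟩ := hI.bddAbove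
  obtain ⟨δ, hδε, hδ⟩ : ∃ δ, (∀ k ∈ I, δ < ε k) ∧ δ ∈ Set.Ioi (0 : ℝ) :=
    (((eventually_all_finite hI).2 fun k _ => mem_nhdsWithin_of_mem_nhds (Iio_mem_nhds (hε k))).and
      self_mem_nhdsWithin).exists (f := 𝓝[>] (0 : ℝ))
  refine ⟨K, δ, hδ, fun ν hν => hVU (htV fun k hk => hεt k ?_)⟩
  rw [Metric.mem_ball, dist_eq_norm]
  exact (hν k (hK hk)).trans_lt (hδε k hk)

theorem moment_convex {μ ν ξ : ProbabilityMeasure Circle} {s t : ℝ≥0}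
    (h : (ξ : Measure Circle) = s • (μ : Measure Circle) + t • (ν : Measure Circle)) (k : ℕ) :
    moment ξ k = s * moment μ k + t * moment ν k := by
  have hc : Continuous fun z : Circle => (z : ℂ) ^ k := by fun_prop
  rw [moment, h, integral_add_measure (integrable_circle hc _) (integrable_circle hc _),
    integral_smul_nnreal_measure, integral_smul_nnreal_measure]
  simp [moment, NNReal.smul_def]

theorem norm_moment_le (μ : ProbabilityMeasure Circle) (k : ℕ) : ‖moment μ k‖ ≤ 1 := by
  refine (norm_integral_le_of_norm_le_const (C := 1) ?_).trans (by simp)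
  exact Eventually.of_forall fun z => by rw [norm_pow, Circle.norm_coe, one_pow]

theorem moment_empiricalMeasure {N : ℕ} [NeZero N] {U : Matrix (Fin N) (Fin N) ℂ}
    (hU : U ∈ Matrix.unitaryGroup (Fin N) ℂ) (k : ℕ) :
    moment (empiricalMeasure U) k = (N : ℂ)⁻¹ * (U ^ k).trace := by
  have hc : Continuous fun z : Circle => (z : ℂ) ^ k := by fun_prop
  have key : ∀ s : Multiset ℂ, (∀ z ∈ s, ‖z‖ = 1) →
      Integrable (fun z : Circle => (z : ℂ) ^ k)
        ((s.map fun z => Measure.dirac (Circle.exp z.arg)).sum : Measure Circle) ∧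
      ∫ z : Circle, (z : ℂ) ^ k ∂((s.map fun z => Measure.dirac (Circle.exp z.arg)).sum :
        Measure Circle) = (s.map (· ^ k)).sum := by
    intro s
    induction s using Multiset.induction_on with
    | empty => simp
    | cons z s ih =>
      intro hs
      obtain ⟨h1, h2⟩ := ih fun w hw => hs w (Multiset.mem_cons_of_mem hw)
      have hz : (Circle.exp z.arg : ℂ) = z := by
        have := Complex.norm_mul_exp_arg_mul_I z
        rw [hs z (Multiset.mem_cons_self z s)] at this
        simpa using this
      simp only [Multiset.map_cons, Multiset.sum_cons]
      have h3 := integrable_circle hc (Measure.dirac (Circle.exp z.arg))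
      refine ⟨h3.add_measure h1, ?_⟩
      rw [integral_add_measure h3 h1, h2, integral_dirac, hz]
  have hk := (key U.charpoly.roots fun z hz => Matrix.norm_eq_one_of_mem_roots_charpoly hU hz).2
  rw [Matrix.trace_pow_eq_sum_roots, ← hk, moment]
  simp only [empiricalMeasure, ProbabilityMeasure.coe_mk]
  rw [integral_smul_measure]
  simp

/-! ### Trace events and their probabilities -/

/-- The coefficients for which the traces of the first powers of the periodic CMV matrix, up to
order `K`, are `δ`-close to the prescribed values `c`. -/
def traceSet (N K : ℕ) (c : ℕ → ℂ) (δ : ℝ) : Set (Fin N → ℂ) :=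
  {a | ∀ k ≤ K, ‖(periodicCMV a ^ k).trace - c k‖ ≤ δ}

theorem isClosed_traceSet (N K : ℕ) (c : ℕ → ℂ) (δ : ℝ) : IsClosed (traceSet N K c δ) := by
  simp only [traceSet, Set.ofPred_forall]
  exact isClosed_iInter fun k => isClosed_iInter fun _ =>
    isClosed_le ((continuous_trace_periodicCMV_pow N k).sub continuous_const).norm continuous_const

/-- The probability of `traceSet` for independent coefficients of law `σ`. -/
noncomputable def traceProb (σ : Measure ℂ) (N K : ℕ) (c : ℕ → ℂ) (δ : ℝ) : ℝ≥0∞ :=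
  Measure.pi (fun _ : Fin N => σ) (traceSet N K c δ)

variable {σ : Measure ℂ}

theorem ae_pi_norm_le_one [IsProbabilityMeasure σ] (hσ : ∀ᵐ z ∂σ, ‖z‖ ≤ 1) (N : ℕ) :
    ∀ᵐ a ∂(Measure.pi fun _ : Fin N => σ), ∀ j, ‖a j‖ ≤ 1 :=
  ae_all_iff.2 fun j =>
    (Measure.tendsto_eval_ae_ae (μ := fun _ : Fin N => σ) (i := j)).eventually hσ

theorem measurePreserving_append (σ : Measure ℂ) [SigmaFinite σ] (N M : ℕ) :
    MeasurePreserving (fun p : (Fin N → ℂ) × (Fin M → ℂ) => Fin.append p.1 p.2)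
      ((Measure.pi fun _ => σ).prod (Measure.pi fun _ => σ)) (Measure.pi fun _ => σ) := by
  have h1 := measurePreserving_sumPiEquivProdPi_symm (fun _ : Fin N ⊕ Fin M => σ)
  have h2 := measurePreserving_piCongrLeft (fun _ : Fin (N + M) => σ)
    (finSumFinEquiv (m := N) (n := M))
  convert h2.comp h1 using 1
  ext p j
  obtain ⟨r, rfl⟩ := (finSumFinEquiv (m := N) (n := M)).surjective j
  rcases r with i | i
  · refine Eq.trans ?_ (Equiv.piCongrLeft_sumInl (fun _ => ℂ) finSumFinEquiv p.1 p.2 i).symm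
    simp
  · refine Eq.trans ?_ (Equiv.piCongrLeft_sumInr (fun _ => ℂ) finSumFinEquiv p.1 p.2 i).symm
    simp

theorem traceProb_mono {N K : ℕ} {c c' : ℕ → ℂ} {δ δ' η : ℝ}
    (hc : ∀ k ≤ K, ‖c k - c' k‖ ≤ η) (h : δ + η ≤ δ') :
    traceProb σ N K c δ ≤ traceProb σ N K c' δ' := by
  refine measure_mono fun a ha k hk => ?_
  have := norm_add_le ((periodicCMV a ^ k).trace - c k) (c k - c' k)
  rw [sub_add_sub_cancel] at this
  linarith [ha k hk, hc k hk]

/-- Supermultiplicativity of the probabilities, with an error `8 K` in the radius that does not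
depend on the sizes. -/
theorem traceProb_mul_le [IsProbabilityMeasure σ] (hσ : ∀ᵐ z ∂σ, ‖z‖ ≤ 1)
    {N M : ℕ} (hN : Even N) (hM : Even M) (K : ℕ)
    (c c' : ℕ → ℂ) (δ δ' : ℝ) :
    traceProb σ N K c δ * traceProb σ M K c' δ' ≤
      traceProb σ (N + M) K (c + c') (δ + δ' + 8 * K) := by
  have hmp := measurePreserving_append σ N M
  rw [traceProb, traceProb, traceProb, ← Measure.prod_prod,
    ← hmp.measure_preimage (isClosed_traceSet _ _ _ _).nullMeasurableSet]
  refine measure_mono_ae ?_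
  filter_upwards [hmp.quasiMeasurePreserving.ae (ae_pi_norm_le_one hσ (N + M))] with p hp hmem
  replace hmem : p.1 ∈ traceSet N K c δ ∧ p.2 ∈ traceSet M K c' δ' := hmem
  change Fin.append p.1 p.2 ∈ traceSet (N + M) K (c + c') (δ + δ' + 8 * K)
  intro k hk
  have h := norm_trace_periodicCMV_append_sub_le hN hM (a := p.1) (b := p.2)
    (fun j => by simpa using hp (Fin.castAdd M j)) (fun j => by simpa using hp (Fin.natAdd N j)) k
  have h1 := hmem.1 k hk
  have h2 := hmem.2 k hk
  have hkK : (k : ℝ) ≤ K := by exact_mod_cast hk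
  rw [show (periodicCMV (Fin.append p.1 p.2) ^ k).trace - (c + c') k
    = ((periodicCMV (Fin.append p.1 p.2) ^ k).trace
      - ((periodicCMV p.1 ^ k).trace + (periodicCMV p.2 ^ k).trace))
      + ((periodicCMV p.1 ^ k).trace - c k) + ((periodicCMV p.2 ^ k).trace - c' k) by
    simp only [Pi.add_apply]
    ring]
  refine norm_add₃_le.trans ?_
  linarith

theorem traceProb_eq_one [IsProbabilityMeasure σ] (hσ : ∀ᵐ z ∂σ, ‖z‖ ≤ 1)
    {N : ℕ} (hN : Even N) {K : ℕ}
    {c : ℕ → ℂ} (hc : ∀ k, ‖c k‖ ≤ N) {δ : ℝ} (hδ : 2 * N ≤ δ) : traceProb σ N K c δ = 1 := by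
  refine le_antisymm prob_le_one (measure_univ.symm.le.trans (measure_mono_ae ?_))
  filter_upwards [ae_pi_norm_le_one hσ N] with a ha _
  change a ∈ traceSet N K c δ
  intro k _
  refine (norm_sub_le _ _).trans ?_
  linarith [norm_trace_periodicCMV_pow_le hN ha k, hc k]

/-- Iterated supermultiplicativity, for `j` pieces of size `N` and one piece of size `r` about which
nothing is assumed. -/
theorem pow_traceProb_le [IsProbabilityMeasure σ] (hσ : ∀ᵐ z ∂σ, ‖z‖ ≤ 1)
    {N r : ℕ} (hN : Even N) (hr : Even r) (K : ℕ)
    {m : ℕ → ℂ} (hm : ∀ k, ‖m k‖ ≤ 1) (δ : ℝ) (j : ℕ) :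
    traceProb σ N K (fun k => N * m k) δ ^ j ≤
      traceProb σ (r + j * N) K (fun k => (r + j * N : ℕ) * m k) (2 * r + j * (δ + 8 * K)) := by
  induction j with
  | zero =>
    refine le_of_eq ?_
    rw [pow_zero, traceProb_eq_one hσ]
    · simpa using hr
    · intro k
      simpa using mul_le_of_le_one_right (Nat.cast_nonneg r) (hm k)
    · simp
  | succ j ih =>
    rw [pow_succ]
    refine (mul_le_mul_left ih _).trans ?_
    refine (traceProb_mul_le hσ (hr.add (hN.mul_left j)) hN K _ _ _ _).trans (le_of_eq ?_)
    rw [show r + (j + 1) * N = r + j * N + N by ring]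
    congr 1
    · ext k
      simp only [Pi.add_apply]
      push_cast
      ring
    · push_cast
      ring

/-! ### Lower bounds for the probabilities -/

/-- `Good σ a μ` says that the empirical measure lies near `μ` with probability at least
`exp (-a N)`, for all large even `N`, however small the neighbourhood of `μ`. The neighbourhoods are
given by moments, and the event is expressed by traces, which are `N` times the moments. -/
def Good (σ : Measure ℂ) (a : ℝ≥0) (μ : ProbabilityMeasure Circle) : Prop :=
  ∀ K : ℕ, ∀ ε > 0, ∀ᶠ N : ℕ in atTop, Even N →
    ENNReal.ofReal (Real.exp (-(a * N))) ≤ traceProb σ N K (fun k => N * moment μ k) (N * ε)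

/-- The subadditivity argument: it suffices that, for each neighbourhood, the lower bound holds for
arbitrarily large even `N`. One such size `N₀` gives all larger sizes by concatenating pieces of
size `N₀` and a remainder, at the price of a larger neighbourhood. -/
theorem good_of_frequently [IsProbabilityMeasure σ] (hσ : ∀ᵐ z ∂σ, ‖z‖ ≤ 1)
    {a : ℝ≥0} {μ : ProbabilityMeasure Circle}
    (h : ∀ K : ℕ, ∀ ε > 0, ∃ᶠ N : ℕ in atTop, Even N ∧
      ENNReal.ofReal (Real.exp (-(a * N))) ≤ traceProb σ N K (fun k => N * moment μ k) (N * ε)) :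
    Good σ a μ := by
  intro K ε hε
  have hlarge : ∀ᶠ N : ℕ in atTop, 32 * K / ε < N ∧ 0 < N :=
    (tendsto_natCast_atTop_atTop.eventually_gt_atTop _).and (eventually_gt_atTop 0)
  -- `N₀` is so large that the concatenation errors `8 K` are small compared to `N₀ ε`.
  obtain ⟨N₀, ⟨hN₀, hp⟩, hKN, hpos⟩ := ((h K (ε / 2) (by positivity)).and_eventually hlarge).exists
  rw [div_lt_iff₀ hε] at hKN
  filter_upwards [tendsto_natCast_atTop_atTop.eventually_gt_atTop (N₀ + 8 * N₀ / ε)] with N hN hNe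
  have hdiv : N % N₀ + N / N₀ * N₀ = N := Nat.mod_add_div' N N₀
  have hr : Even (N % N₀) := by
    have := hdiv ▸ hNe
    rw [Nat.even_add] at this
    exact this.2 (hN₀.mul_left _)
  have key := pow_traceProb_le hσ hN₀ hr K (norm_moment_le μ) (N₀ * (ε / 2)) (N / N₀)
  rw [hdiv] at key
  set r := N % N₀ with hr_def
  set j := N / N₀
  have hrN : (r : ℝ) ≤ N₀ := by exact_mod_cast (Nat.mod_lt N hpos).le
  have hcast : (N : ℝ) = r + j * N₀ := by exact_mod_cast hdiv.symm
  have hr0 : (0 : ℝ) ≤ r := Nat.cast_nonneg r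
  have hj0 : (0 : ℝ) ≤ j := Nat.cast_nonneg j
  have hjN : 8 * (N₀ : ℝ) ≤ j * N₀ * ε := by
    have : 8 * N₀ / ε < j * (N₀ : ℝ) := by linarith
    rw [div_lt_iff₀ hε] at this
    exact this.le
  calc ENNReal.ofReal (Real.exp (-(a * N)))
      ≤ ENNReal.ofReal (Real.exp (-(a * N₀)) ^ j) := by
        rw [← Real.exp_nat_mul]
        refine ENNReal.ofReal_le_ofReal (Real.exp_le_exp.2 ?_)
        rw [hcast]
        have : 0 ≤ (a : ℝ) * r := by positivity
        linarith
    _ = ENNReal.ofReal (Real.exp (-(a * N₀))) ^ j := ENNReal.ofReal_pow (Real.exp_pos _).le _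
    _ ≤ _ := pow_le_pow_left₀ zero_le hp j
    _ ≤ _ := key
    _ ≤ _ := by
      refine traceProb_mono (η := 0) (by simp) ?_
      rw [hcast]
      have : (j : ℝ) * (32 * K) ≤ j * (N₀ * ε) := mul_le_mul_of_nonneg_left hKN.le hj0
      have : 0 ≤ (r : ℝ) * ε := by positivity
      linarith

theorem Good.mono {a b : ℝ≥0} (hab : a ≤ b) {μ : ProbabilityMeasure Circle} (h : Good σ a μ) :
    Good σ b μ := by
  intro K ε hε
  filter_upwards [h K ε hε] with N hN hNe
  refine le_trans (ENNReal.ofReal_le_ofReal (Real.exp_le_exp.2 ?_)) (hN hNe)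
  gcongr

theorem exists_lt_of_not_good [IsProbabilityMeasure σ] (hσ : ∀ᵐ z ∂σ, ‖z‖ ≤ 1)
    {a : ℝ≥0} {μ : ProbabilityMeasure Circle}
    (h : ¬ Good σ a μ) : ∃ K : ℕ, ∃ ε > 0, ∀ᶠ N : ℕ in atTop, Even N →
      traceProb σ N K (fun k => N * moment μ k) (N * ε) < ENNReal.ofReal (Real.exp (-(a * N))) := by
  contrapose! h
  refine good_of_frequently hσ fun K ε hε => ?_
  simpa [Filter.Frequently, not_eventually] using h K ε hε

theorem isClosed_setOf_good [IsProbabilityMeasure σ] (hσ : ∀ᵐ z ∂σ, ‖z‖ ≤ 1)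
    (a : ℝ≥0) : IsClosed {μ | Good σ a μ} := by
  rw [← isOpen_compl_iff, isOpen_iff_mem_nhds]
  intro μ hμ
  obtain ⟨K, ε, hε, hlt⟩ := exists_lt_of_not_good hσ hμ
  filter_upwards [momentBall_mem_nhds μ K (half_pos hε)] with ν hν hgood
  have hev : ∀ᶠ N : ℕ in atTop, ¬ Even N := by
    filter_upwards [hlt, hgood K (ε / 2) (half_pos hε)] with N h1 h2 hN
    refine absurd ((h2 hN).trans (traceProb_mono (η := N * (ε / 2)) ?_ ?_)) (not_le.2 (h1 hN))
    · intro k hk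
      rw [← mul_sub, norm_mul, Complex.norm_natCast]
      exact mul_le_mul_of_nonneg_left (hν k hk) (Nat.cast_nonneg N)
    · linarith
  obtain ⟨N, hN⟩ := eventually_atTop.1 hev
  exact hN (2 * N) (by omega) (even_two_mul N)

/-- Convexity: concatenating coefficients that produce `μ` and `ν`, in the proportion `s : t`,
produces `s μ + t ν`. -/
theorem Good.convex [IsProbabilityMeasure σ] (hσ : ∀ᵐ z ∂σ, ‖z‖ ≤ 1)
    {a b c s t : ℝ≥0} {μ ν ξ : ProbabilityMeasure Circle}
    (hs : 0 < s) (ht : 0 < t) (hst : s + t = 1)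
    (hξ : (ξ : Measure Circle) = s • (μ : Measure Circle) + t • (ν : Measure Circle))
    (hμ : Good σ a μ) (hν : Good σ b ν) (hc : s * a + t * b < c) : Good σ c ξ := by
  intro K ε hε
  have hst' : (s : ℝ) + t = 1 := by exact_mod_cast hst
  have hs' : (0 : ℝ) < s := by exact_mod_cast hs
  have ht' : (0 : ℝ) < t := by exact_mod_cast ht
  have hc' : (s * a + t * b : ℝ) < c := by exact_mod_cast hc
  -- `N₁` and `N₂` are even, add up to `N` and are close to `s N` and `t N`.
  let N₁ : ℕ → ℕ := fun N => 2 * ⌊(s : ℝ) * N / 2⌋₊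
  have h1 : ∀ N : ℕ, (N₁ N : ℝ) ≤ s * N := fun N => by
    have := Nat.floor_le (show 0 ≤ (s : ℝ) * N / 2 by positivity)
    simp only [N₁]
    push_cast
    linarith
  have h2 : ∀ N : ℕ, s * N - 2 ≤ (N₁ N : ℝ) := fun N => by
    have := Nat.lt_floor_add_one ((s : ℝ) * N / 2)
    simp only [N₁]
    push_cast
    linarith
  have hle : ∀ N : ℕ, N₁ N ≤ N := fun N => by
    have : (N₁ N : ℝ) ≤ N := (h1 N).trans (mul_le_of_le_one_left (Nat.cast_nonneg N) (by linarith))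
    exact_mod_cast this
  have hcast : ∀ N : ℕ, ((N - N₁ N : ℕ) : ℝ) = N - N₁ N := fun N => Nat.cast_sub (hle N)
  have hNat : Tendsto (fun N : ℕ => (N : ℝ)) atTop atTop := tendsto_natCast_atTop_atTop
  have lim1 : Tendsto N₁ atTop atTop := by
    refine tendsto_natCast_atTop_iff (R := ℝ) |>.1 (tendsto_atTop_mono h2 ?_)
    exact tendsto_atTop_add_const_right _ _ (hNat.const_mul_atTop hs')
  have lim2 : Tendsto (fun N => N - N₁ N) atTop atTop := by
    refine tendsto_natCast_atTop_iff (R := ℝ) |>.1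
      (tendsto_atTop_mono (fun N => ?_) (hNat.const_mul_atTop ht'))
    rw [hcast]
    have := h1 N
    have : (N : ℝ) = s * N + t * N := by rw [← add_mul, hst', one_mul]
    linarith
  filter_upwards [lim1.eventually (hμ K (ε / 2) (half_pos hε)),
    lim2.eventually (hν K (ε / 2) (half_pos hε)),
    hNat.eventually_ge_atTop (2 * b / (c - (s * a + t * b))),
    hNat.eventually_ge_atTop ((4 + 8 * K) / (ε / 2))] with N e1 e2 e3 e4 hN
  rw [div_le_iff₀ (by linarith)] at e3
  rw [div_le_iff₀ (by linarith)] at e4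
  have hN₁ : Even (N₁ N) := even_two_mul _
  have hN₂ : Even (N - N₁ N) := hN.tsub hN₁
  have hsplit : (N : ℝ) = s * N + t * N := by rw [← add_mul, hst', one_mul]
  have hlow := h2 N
  have hup := h1 N
  calc ENNReal.ofReal (Real.exp (-(c * N)))
      ≤ ENNReal.ofReal (Real.exp (-(a * N₁ N)) * Real.exp (-(b * (N - N₁ N : ℕ)))) := by
        rw [← Real.exp_add]
        refine ENNReal.ofReal_le_ofReal (Real.exp_le_exp.2 ?_)
        rw [hcast]
        have i1 : (a : ℝ) * N₁ N ≤ a * (s * N) := mul_le_mul_of_nonneg_left hup a.2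
        have i2 : (b : ℝ) * (N - N₁ N) ≤ b * (t * N + 2) :=
          mul_le_mul_of_nonneg_left (by linarith) b.2
        linarith
    _ = _ := ENNReal.ofReal_mul (Real.exp_pos _).le
    _ ≤ _ := mul_le_mul' (e1 hN₁) (e2 hN₂)
    _ ≤ _ := traceProb_mul_le hσ hN₁ hN₂ K _ _ _ _
    _ ≤ traceProb σ (N₁ N + (N - N₁ N)) K (fun k => N * moment ξ k) (N * ε) := by
      refine traceProb_mono (η := 4) (fun k _ => ?_) ?_
      · have hrw : ((fun k => (N₁ N : ℂ) * moment μ k) +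
            fun k => ((N - N₁ N : ℕ) : ℂ) * moment ν k) k
            - N * moment ξ k = ((s * N - N₁ N : ℝ) : ℂ) * (moment ν k - moment μ k) := by
          have ht1 : (t : ℂ) = 1 - s := by
            rw [eq_sub_iff_add_eq, add_comm]
            exact_mod_cast hst
          rw [moment_convex hξ, Pi.add_apply, Nat.cast_sub (hle N)]
          push_cast
          rw [ht1]
          ring
        rw [hrw, norm_mul, Complex.norm_real, Real.norm_eq_abs, abs_of_nonneg (by linarith)]
        have := norm_sub_le (moment ν k) (moment μ k)
        have := norm_moment_le μ k
        have := norm_moment_le ν k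
        calc _ ≤ (2 : ℝ) * 2 := mul_le_mul (by linarith) (by linarith) (norm_nonneg _) (by norm_num)
          _ = 4 := by norm_num
      · rw [hcast]
        linarith
    _ = _ := by rw [Nat.add_sub_cancel' (hle N)]

/-! ### The rate function -/

/-- The rate function: the infimum of the `a` such that, for every neighbourhood of `μ`, the
empirical measure lies in it with probability at least `exp (-a N)` for all large even `N`.
It is `⊤` when there is no such `a`. -/
noncomputable def rate (σ : Measure ℂ) (μ : ProbabilityMeasure Circle) : ℝ≥0∞ :=
  ⨅ (a : ℝ≥0) (_ : Good σ a μ), (a : ℝ≥0∞)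

theorem rate_le {a : ℝ≥0} {μ : ProbabilityMeasure Circle} (h : Good σ a μ) : rate σ μ ≤ a :=
  iInf₂_le a h

theorem good_of_rate_lt {a : ℝ≥0} {μ : ProbabilityMeasure Circle} (h : rate σ μ < a) :
    Good σ a μ := by
  simp only [rate, iInf_lt_iff] at h
  obtain ⟨b, hb, hba⟩ := h
  exact hb.mono (by exact_mod_cast hba.le)

theorem isCompact_setOf_rate_le [IsProbabilityMeasure σ] (hσ : ∀ᵐ z ∂σ, ‖z‖ ≤ 1) (a : ℝ≥0) :
    IsCompact {μ | rate σ μ ≤ a} := by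
  have h : {μ | rate σ μ ≤ a} = ⋂ b ∈ Set.Ioi a, {μ | Good σ b μ} := by
    ext μ
    simp only [Set.mem_ofPred_eq, Set.mem_iInter, Set.mem_Ioi]
    refine ⟨fun h b hb => good_of_rate_lt (h.trans_lt (by exact_mod_cast hb)), fun h => ?_⟩
    refine ENNReal.le_of_forall_pos_le_add fun ε hε _ => ?_
    exact_mod_cast rate_le (h (a + ε) (lt_add_of_pos_right a hε))
  rw [h]
  exact (isClosed_biInter fun b _ => isClosed_setOf_good hσ b).isCompact

theorem rate_convex [IsProbabilityMeasure σ] (hσ : ∀ᵐ z ∂σ, ‖z‖ ≤ 1)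
    {μ ν ξ : ProbabilityMeasure Circle} {s t : ℝ≥0} (hst : s + t = 1)
    (hξ : (ξ : Measure Circle) = s • (μ : Measure Circle) + t • (ν : Measure Circle)) :
    rate σ ξ ≤ s * rate σ μ + t * rate σ ν := by
  rcases eq_or_ne s 0 with rfl | hs
  · obtain rfl : t = 1 := by simpa using hst
    obtain rfl : ξ = ν := Subtype.ext (by simpa using hξ)
    simp
  rcases eq_or_ne t 0 with rfl | ht
  · obtain rfl : s = 1 := by simpa using hst
    obtain rfl : ξ = μ := Subtype.ext (by simpa using hξ)
    simp
  by_cases hμ : rate σ μ = ⊤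
  · simp [hμ, hs]
  by_cases hν : rate σ ν = ⊤
  · simp [hν, ht]
  lift rate σ μ to ℝ≥0 using hμ with x hx
  lift rate σ ν to ℝ≥0 using hν with y hy
  refine ENNReal.le_of_forall_pos_le_add fun ε hε _ => ?_
  have hε2 : 0 < ε / 2 := half_pos hε
  have hgμ : Good σ (x + ε / 2) μ :=
    good_of_rate_lt (by rw [← hx]; exact_mod_cast lt_add_of_pos_right x hε2)
  have hgν : Good σ (y + ε / 2) ν :=
    good_of_rate_lt (by rw [← hy]; exact_mod_cast lt_add_of_pos_right y hε2)
  have hlt : s * (x + ε / 2) + t * (y + ε / 2) < s * x + t * y + ε := by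
    have : s * (x + ε / 2) + t * (y + ε / 2) = s * x + t * y + (s + t) * (ε / 2) := by ring
    rw [this, hst, one_mul]
    gcongr
    exact NNReal.half_lt_self hε.ne'
  exact_mod_cast rate_le
    (hgμ.convex hσ (pos_iff_ne_zero.2 hs) (pos_iff_ne_zero.2 ht) hst hξ hgν hlt)

/-! ### Large deviation bounds -/

/-- The event that the empirical measure lies in `momentBall` is described by traces, so its
probability depends on the law of the coefficients only. Off the closed unit disc the two events
may differ, but the coefficients almost surely do not take such values. -/
theorem measure_empiricalMeasure_mem_momentBall [IsProbabilityMeasure σ] (hσ : ∀ᵐ z ∂σ, ‖z‖ ≤ 1)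
    {Ω : Type*} [MeasurableSpace Ω] {P : Measure Ω} [IsProbabilityMeasure P] {α : ℕ → Ω → ℂ}
    (hlaw : ∀ i, HasLaw (α i) σ P) (hind : iIndepFun α P) {N : ℕ} [NeZero N] (hN : Even N)
    (μ : ProbabilityMeasure Circle) (K : ℕ) (ε : ℝ) :
    P {ω | empiricalMeasure (periodicCMV fun j : Fin N => α j ω) ∈ momentBall μ K ε} =
      traceProb σ N K (fun k => N * moment μ k) (N * ε) := by
  have hmeas : ∀ j : Fin N, AEMeasurable (α j) P := fun j => (hlaw j).aemeasurable
  have hmap : P.map (fun ω (j : Fin N) => α j ω) = Measure.pi fun _ => σ := by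
    rw [(iIndepFun_iff_map_fun_eq_pi_map hmeas).1 (hind.precomp Fin.val_injective)]
    simp only [(hlaw _).map_eq]
  have hvec : AEMeasurable (fun ω (j : Fin N) => α j ω) P := aemeasurable_pi_lambda _ hmeas
  rw [traceProb, ← hmap,
    Measure.map_apply_of_aemeasurable hvec (isClosed_traceSet _ _ _ _).measurableSet]
  refine measure_congr ?_
  have hae : ∀ᵐ ω ∂P, ∀ j : Fin N, ‖α j ω‖ ≤ 1 :=
    ae_of_ae_map hvec (by rw [hmap]; exact ae_pi_norm_le_one hσ N)
  filter_upwards [hae] with ω hω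
  refine propext (forall₂_congr fun k _ => ?_)
  have hN0 : (0 : ℝ) < N := by exact_mod_cast Nat.pos_of_ne_zero (NeZero.ne N)
  have hN0' : (N : ℂ) ≠ 0 := by exact_mod_cast NeZero.ne N
  rw [moment_empiricalMeasure (periodicCMV_mem_unitaryGroup hN hω),
    ← mul_le_mul_iff_right₀ hN0, ← Complex.norm_natCast, ← norm_mul, mul_sub,
    mul_inv_cancel_left₀ hN0', Complex.norm_natCast]

theorem log_ofReal_exp_div (x : ℝ) {N : ℕ} (hN : N ≠ 0) :
    ENNReal.log (ENNReal.ofReal (Real.exp (-(x * N)))) / (N : EReal) = ((-x : ℝ) : EReal) := by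
  have hN' : (N : ℝ) ≠ 0 := by exact_mod_cast hN
  rw [ENNReal.log_ofReal_of_pos (Real.exp_pos _), Real.log_exp,
    show (N : EReal) = ((N : ℝ) : EReal) from rfl, ← EReal.coe_div, ← neg_mul,
    mul_div_cancel_right₀ _ hN']

theorem tendsto_two_mul_succ : Tendsto (fun n : ℕ => 2 * (n + 1)) atTop atTop :=
  tendsto_atTop_mono (fun n => show n ≤ 2 * (n + 1) by omega) tendsto_id

section LargeDeviations

variable [IsProbabilityMeasure σ] {Ω : Type*} [MeasurableSpace Ω] {P : Measure Ω}
  [IsProbabilityMeasure P] {α : ℕ → Ω → ℂ}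

theorem le_liminf_of_isOpen (hσ : ∀ᵐ z ∂σ, ‖z‖ ≤ 1) (hlaw : ∀ i, HasLaw (α i) σ P)
    (hind : iIndepFun α P) {O : Set (ProbabilityMeasure Circle)} (hO : IsOpen O) :
    -((⨅ μ ∈ O, rate σ μ : ℝ≥0∞) : EReal) ≤
      liminf (fun n : ℕ => ENNReal.log (P {ω | empiricalMeasure
        (periodicCMV fun j : Fin (2 * (n + 1)) => α j ω) ∈ O})
        / ((2 * (n + 1) : ℕ) : EReal)) atTop := by
  by_contra! hlt
  obtain ⟨x, hx1, hx2⟩ := EReal.lt_iff_exists_real_btwn.1 hlt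
  rw [EReal.lt_neg_comm, ← EReal.coe_neg] at hx2
  have hx : 0 ≤ -x := by
    have := (EReal.coe_ennreal_nonneg _).trans hx2.le
    exact_mod_cast this
  obtain ⟨a, ha⟩ : ∃ a : ℝ≥0, (a : ℝ) = -x := ⟨⟨-x, hx⟩, rfl⟩
  rw [← ha] at hx2
  have hx3 : (⨅ μ ∈ O, rate σ μ) < (a : ℝ≥0∞) := EReal.coe_ennreal_lt_coe_ennreal_iff.1 hx2
  simp only [iInf_lt_iff] at hx3
  obtain ⟨μ, hμO, hμ⟩ := hx3
  obtain ⟨K, ε, hε, hsub⟩ := exists_momentBall_subset (hO.mem_nhds hμO)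
  have hev := tendsto_two_mul_succ.eventually (good_of_rate_lt hμ K ε hε)
  refine absurd (le_liminf_of_le (a := (x : EReal)) ?_ ?_) (not_le.2 hx1)
  · isBoundedDefault
  · filter_upwards [hev] with n hn
    have h := hn (even_two_mul _)
    rw [← measure_empiricalMeasure_mem_momentBall hσ hlaw hind (even_two_mul _)] at h
    have h' := ENNReal.log_le_log (h.trans (measure_mono fun ω hω => hsub hω))
    have := EReal.div_le_div_right_of_nonneg (c := ((2 * (n + 1) : ℕ) : EReal))
      (Nat.cast_nonneg' _) h'
    rwa [log_ofReal_exp_div _ (by omega), ha, neg_neg] at this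

theorem limsup_le_of_isClosed (hσ : ∀ᵐ z ∂σ, ‖z‖ ≤ 1) (hlaw : ∀ i, HasLaw (α i) σ P)
    (hind : iIndepFun α P) {F : Set (ProbabilityMeasure Circle)} (hF : IsClosed F) :
    limsup (fun n : ℕ => ENNReal.log (P {ω | empiricalMeasure
        (periodicCMV fun j : Fin (2 * (n + 1)) => α j ω) ∈ F})
        / ((2 * (n + 1) : ℕ) : EReal)) atTop ≤
      -((⨅ μ ∈ F, rate σ μ : ℝ≥0∞) : EReal) := by
  by_contra! hlt
  obtain ⟨x, hx1, hx2⟩ := EReal.lt_iff_exists_real_btwn.1 hlt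
  obtain ⟨y, hy1, hy2⟩ := EReal.lt_iff_exists_real_btwn.1 hx1
  replace hy2 : y < x := by exact_mod_cast hy2
  -- The exponents are nonpositive since the probabilities are at most one.
  have hx : x < 0 := by
    have h0 : limsup (fun n : ℕ => ENNReal.log (P {ω | empiricalMeasure
        (periodicCMV fun j : Fin (2 * (n + 1)) => α j ω) ∈ F})
        / ((2 * (n + 1) : ℕ) : EReal)) atTop ≤ 0 := by
      refine limsup_le_of_le (by isBoundedDefault) (Eventually.of_forall fun n => ?_)
      exact EReal.div_nonpos_of_nonpos_of_nonneg (ENNReal.log_le_zero_iff.2 prob_le_one)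
        (Nat.cast_nonneg' _)
    exact_mod_cast hx2.trans_le h0
  obtain ⟨b, hb⟩ : ∃ b : ℝ≥0, (b : ℝ) = -y := ⟨⟨-y, by linarith⟩, rfl⟩
  have hbF : ∀ μ ∈ F, ¬ Good σ b μ := by
    intro μ hμ hgood
    have h1 : (⨅ μ ∈ F, rate σ μ) ≤ (b : ℝ≥0∞) := (iInf₂_le μ hμ).trans (rate_le hgood)
    have h2 : ((⨅ μ ∈ F, rate σ μ : ℝ≥0∞) : EReal) ≤ ((-y : ℝ) : EReal) := by
      rw [← hb]
      exact EReal.coe_ennreal_le_coe_ennreal_iff.2 h1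
    rw [EReal.neg_lt_comm, ← EReal.coe_neg] at hy1
    exact absurd hy1 (not_lt.2 h2)
  choose! K ε hε hsmall using fun μ hμ => exists_lt_of_not_good hσ (hbF μ hμ)
  obtain ⟨T, hTF, hcover⟩ := hF.isCompact.elim_nhds_subcover
    (fun μ => momentBall μ (K μ) (ε μ)) fun μ hμ => momentBall_mem_nhds μ (K μ) (hε μ hμ)
  have hev : ∀ᶠ n : ℕ in atTop, ∀ μ ∈ T, P {ω | empiricalMeasure
      (periodicCMV fun j : Fin (2 * (n + 1)) => α j ω) ∈ momentBall μ (K μ) (ε μ)} ≤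
      ENNReal.ofReal (Real.exp (-(b * (2 * (n + 1) : ℕ)))) := by
    refine (eventually_all_finset T).2 fun μ hμ => ?_
    filter_upwards [tendsto_two_mul_succ.eventually (hsmall μ (hTF μ hμ))] with n hn
    rw [measure_empiricalMeasure_mem_momentBall hσ hlaw hind (even_two_mul _)]
    exact (hn (even_two_mul _)).le
  -- The number of balls in the cover is absorbed by the gap between `x` and `y`.
  have hcard : ∀ᶠ n : ℕ in atTop, (T.card : ℝ) ≤ Real.exp ((x - y) * (2 * (n + 1) : ℕ)) := by
    have h1 : Tendsto (fun n : ℕ => ((2 * (n + 1) : ℕ) : ℝ)) atTop atTop :=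
      tendsto_natCast_atTop_atTop.comp tendsto_two_mul_succ
    exact (Real.tendsto_exp_atTop.comp
      (h1.const_mul_atTop (sub_pos.2 hy2))).eventually_ge_atTop _
  refine absurd (limsup_le_of_le (a := (x : EReal)) (by isBoundedDefault) ?_) (not_le.2 hx2)
  filter_upwards [hev, hcard] with n hn hc
  have hbound : P {ω | empiricalMeasure (periodicCMV fun j : Fin (2 * (n + 1)) => α j ω) ∈ F} ≤
      ENNReal.ofReal (Real.exp (-(-x * (2 * (n + 1) : ℕ)))) := by
    calc _ ≤ P (⋃ μ ∈ T, {ω | empiricalMeasure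
          (periodicCMV fun j : Fin (2 * (n + 1)) => α j ω) ∈ momentBall μ (K μ) (ε μ)}) := by
          refine measure_mono fun ω hω => ?_
          simpa only [Set.mem_iUnion, Set.mem_ofPred_eq] using hcover hω
      _ ≤ ∑ μ ∈ T, P {ω | empiricalMeasure
          (periodicCMV fun j : Fin (2 * (n + 1)) => α j ω) ∈ momentBall μ (K μ) (ε μ)} :=
          measure_biUnion_finset_le _ _
      _ ≤ T.card • ENNReal.ofReal (Real.exp (-(b * (2 * (n + 1) : ℕ)))) :=
          Finset.sum_le_card_nsmul _ _ _ hn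
      _ = ENNReal.ofReal (T.card * Real.exp (-(b * (2 * (n + 1) : ℕ)))) := by
          rw [ENNReal.ofReal_mul (Nat.cast_nonneg _), ENNReal.ofReal_natCast, nsmul_eq_mul]
      _ ≤ _ := by
          refine ENNReal.ofReal_le_ofReal ?_
          refine (mul_le_mul_of_nonneg_right hc (Real.exp_pos _).le).trans (le_of_eq ?_)
          rw [← Real.exp_add, hb]
          congr 1
          ring
  have := EReal.div_le_div_right_of_nonneg (c := ((2 * (n + 1) : ℕ) : EReal))
    (Nat.cast_nonneg' _) (ENNReal.log_le_log hbound)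
  rwa [log_ofReal_exp_div _ (by omega), neg_neg] at this

end LargeDeviations

end CMV

theorem proposition2p3 (σ : Measure ℂ) [IsProbabilityMeasure σ]
    (hσ : σ.support ⊆ Metric.closedBall (0 : ℂ) 1) :
    ∃ J : ProbabilityMeasure Circle → ℝ≥0∞,
      -- `J` is convex
      (∀ (μ ν ξ : ProbabilityMeasure Circle) (s t : ℝ≥0), s + t = 1 →
        (ξ : Measure Circle) = s • (μ : Measure Circle) + t • (ν : Measure Circle) →
        J ξ ≤ s * J μ + t * J ν) ∧
      -- the level sets of `J` are compact
      (∀ a : ℝ≥0, IsCompact {μ : ProbabilityMeasure Circle | J μ ≤ a}) ∧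
      -- the large deviation bounds, along even `N = 2 (n + 1)`, for each i.i.d. sequence of law `σ`
      ∀ {Ω : Type*} [MeasurableSpace Ω] (P : Measure Ω) [IsProbabilityMeasure P]
        (α : ℕ → Ω → ℂ), (∀ i, HasLaw (α i) σ P) → iIndepFun α P →
        (∀ O : Set (ProbabilityMeasure Circle), IsOpen O →
          -((⨅ μ ∈ O, J μ : ℝ≥0∞) : EReal) ≤
            liminf (fun n : ℕ =>
              ENNReal.log (P {ω | CMV.empiricalMeasure
                (CMV.periodicCMV fun j : Fin (2 * (n + 1)) => α j ω) ∈ O})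
              / ((2 * (n + 1) : ℕ) : EReal)) atTop) ∧
        (∀ F : Set (ProbabilityMeasure Circle), IsClosed F →
          limsup (fun n : ℕ =>
              ENNReal.log (P {ω | CMV.empiricalMeasure
                (CMV.periodicCMV fun j : Fin (2 * (n + 1)) => α j ω) ∈ F})
              / ((2 * (n + 1) : ℕ) : EReal)) atTop ≤
            -((⨅ μ ∈ F, J μ : ℝ≥0∞) : EReal)) := by
  have hdisc : ∀ᵐ z ∂σ, ‖z‖ ≤ 1 := by
    filter_upwards [Measure.support_mem_ae (μ := σ)] with z hz
    simpa using hσ hz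
  exact ⟨CMV.rate σ, fun μ ν ξ s t hst hξ => CMV.rate_convex hdisc hst hξ,
    CMV.isCompact_setOf_rate_le hdisc, fun P _ α hlaw hind =>
      ⟨fun O hO => CMV.le_liminf_of_isOpen hdisc hlaw hind hO,
        fun F hF => CMV.limsup_le_of_isClosed hdisc hlaw hind hF⟩⟩
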